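/- Let $q$ be a prime power. An \emph{abstract unital of order $q$} is a $2$-$(q^3+1,q+1,1)$ design $U=(X,B)$, i.e. $|X|=q^3+1$, every block $b\in B$ is a set of $q+1$ points, and any two distinct points lie in exactly one block. It is \emph{embedded} in a projective plane $\Pi$ if $X$ consists of points of $\Pi$ and every block is of the form $X\cap\ell$ for some line $\ell$ of $\Pi$. For blocks $b_1,b_2$, a point $P\notin b_1\cup b_2$ is a \emph{full point} with respect to $(b_1,b_2)$ if for each $Q\in b_1$ the block connecting $P$ and $Q$ meets $b_2$; let $F_U(b_1,b_2)$ be the set of full points. Each $P\in F_U(b_1,b_2)$ defines a bijection $\pi_{b_1,P,b_2}:b_1\to b_2$, the perspectivity with center $P$, sending $Q\in b_1$ to the intersection of $b_2$ with the block connecting $P$ and $Q$; and $F_U(b_1,b_2)=F_U(b_2,b_1)$. Let $$\mathrm{Persp}_{b_2}(b_1)=\langle \pi_{b_1,P,b_2}\,\pi_{b_2,Q,b_1} \mid P,Q\in F_U(b_1,b_2)\rangle ,$$ a permutation group on $b_1$ (products are composed from left to right). Theorem. Let $U=(X,B)$ be an abstract unital of order $q$ embedded in the Desarguesian plane $\mathsf{PG}(2,q^2)$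 over the field with $q^2$ elements. Then $U$ is strongly full point regular, that is, for any two disjoint blocks $b_1,b_2$ of $U$: (i) there is a block $c\in B$ with $b_1\cap c=b_2\cap c=\emptyset$ and $F_U(b_1,b_2)\subseteq c$; and (ii) the permutation group $\mathrm{Persp}_{b_2}(b_1)$ is cyclic and semi-regular on $b_1$ (only the identity fixes a point of $b_1$). Moreover, the order of $\mathrm{Persp}_{b_2}(b_1)$ divides $q^2-1$. -/

import Mathlib

open scoped LinearAlgebra.Projectivization

/-- An abstract unital of order `n` on the point set `X`: a `2-(n^3+1, n+1, 1)` design. -/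
structure AbstractUnital (X : Type*) (n : ℕ) where
  /-- the blocks, as sets of points -/
  blocks : Set (Set X)
  card_points : Nat.card X = n ^ 3 + 1
  card_block : ∀ b ∈ blocks, b.ncard = n + 1
  existsUnique_block : ∀ x y : X, x ≠ y → ∃! b : Set X, b ∈ blocks ∧ x ∈ b ∧ y ∈ b

/-- A group of permutations of `α` is semi-regular if all its point stabilizers are trivial. -/
def IsSemiregularPermGroup {α : Type*} (G : Subgroup (Equiv.Perm α)) : Prop :=
  ∀ g ∈ G, ∀ x : α, g x = x → g = 1

namespace AbstractUnital

variable {X : Type*} {n : ℕ}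

/-- `f` embeds the unital `U` in the plane with points `P` and lines `L`: it is injective on points,
and each block corresponds to the intersection of the image of the point set with some line. -/
structure IsEmbedding (U : AbstractUnital X n) {P : Type*} (L : Type*) [Membership P L]
    (f : X → P) : Prop where
  injective : Function.Injective f
  block_eq : ∀ b ∈ U.blocks, ∃ l : L, f '' b = Set.range f ∩ {p | p ∈ l}

/-- The set of full points with respect to the blocks `b₁`, `b₂`: the points `P` outside
`b₁ ∪ b₂` such that for each `Q ∈ b₁` the block connecting `P` and `Q` meets `b₂`. -/
def fullPoints (U : AbstractUnital X n) (b₁ b₂ : Set X) : Set X :=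
  {P | P ∉ b₁ ∪ b₂ ∧
    ∀ Q ∈ b₁, ∃ c ∈ U.blocks, P ∈ c ∧ Q ∈ c ∧ (c ∩ b₂).Nonempty}

/-- `π : b₁ ≃ b₂` is the perspectivity with center `P`: each `Q ∈ b₁` is sent to a point of `b₂`
on the block connecting `P` and `Q`. -/
def IsPerspectivity (U : AbstractUnital X n) (P : X) {b₁ b₂ : Set X} (π : b₁ ≃ b₂) : Prop :=
  ∀ Q : b₁, ∃ c ∈ U.blocks, P ∈ c ∧ (Q : X) ∈ c ∧ (π Q : X) ∈ c

/-- The group of perspectivities of `b₁` with respect to `b₂`, generated by the permutations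
of `b₁` obtained by projecting `b₁` to `b₂` from a full point `P`, and then
`b₂` back to `b₁` from a full point `Q`. -/
def persp (U : AbstractUnital X n) (b₂ b₁ : Set X) : Subgroup (Equiv.Perm b₁) :=
  Subgroup.closure {g | ∃ P ∈ U.fullPoints b₁ b₂, ∃ Q ∈ U.fullPoints b₁ b₂,
    ∃ (π : b₁ ≃ b₂) (σ : b₂ ≃ b₁),
      U.IsPerspectivity P π ∧ U.IsPerspectivity Q σ ∧ g = π.trans σ}

/-- The triple `(U, b₁, b₂)` is full point regular. -/
def IsFullPointRegularTriple (U : AbstractUnital X n) (b₁ b₂ : Set X) : Prop :=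
  ∃ c ∈ U.blocks, b₁ ∩ c = ∅ ∧ b₂ ∩ c = ∅ ∧ U.fullPoints b₁ b₂ ⊆ c

/-- The triple `(U, b₁, b₂)` is strongly full point regular. -/
def IsStronglyFullPointRegularTriple (U : AbstractUnital X n) (b₁ b₂ : Set X) : Prop :=
  U.IsFullPointRegularTriple b₁ b₂ ∧
    IsCyclic (U.persp b₂ b₁) ∧ IsSemiregularPermGroup (U.persp b₂ b₁)

/-- The unital `U` is strongly full point regular. -/
def IsStronglyFullPointRegular (U : AbstractUnital X n) : Prop :=
  ∀ b₁ ∈ U.blocks, ∀ b₂ ∈ U.blocks, Disjoint b₁ b₂ → U.IsStronglyFullPointRegularTriple b₁ b₂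

/-- A full point is the center of exactly one perspectivity. -/
theorem existsUnique_isPerspectivity (U : AbstractUnital X n) {b₁ b₂ : Set X}
    (h₁ : b₁ ∈ U.blocks) (h₂ : b₂ ∈ U.blocks) {P : X} (hP : P ∈ U.fullPoints b₁ b₂) :
    ∃! π : b₁ ≃ b₂, U.IsPerspectivity P π := by
  obtain ⟨hP0, hPf⟩ := hP
  have hP1 : P ∉ b₁ := fun h => hP0 (Or.inl h)
  have hP2 : P ∉ b₂ := fun h => hP0 (Or.inr h)
  have uniq : ∀ {x y : X} {c d : Set X}, x ≠ y → c ∈ U.blocks → d ∈ U.blocks →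
      x ∈ c → y ∈ c → x ∈ d → y ∈ d → c = d := fun hxy hc hd h1 h2 h3 h4 =>
    (U.existsUnique_block _ _ hxy).unique ⟨hc, h1, h2⟩ ⟨hd, h3, h4⟩
  have hf : ∀ Q : b₁, ∃ R : b₂, ∃ c ∈ U.blocks, P ∈ c ∧ (Q : X) ∈ c ∧ (R : X) ∈ c := by
    rintro ⟨Q, hQ⟩
    obtain ⟨c, hc, hPc, hQc, R, hRc, hR⟩ := hPf Q hQ
    exact ⟨⟨R, hR⟩, c, hc, hPc, hQc, hRc⟩
  -- uniqueness of the image of a point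
  have key : ∀ (Q : b₁) (R R' : b₂), (∃ c ∈ U.blocks, P ∈ c ∧ (Q : X) ∈ c ∧ (R : X) ∈ c) →
      (∃ c ∈ U.blocks, P ∈ c ∧ (Q : X) ∈ c ∧ (R' : X) ∈ c) → R = R' := by
    rintro Q R R' ⟨c, hc, hPc, hQc, hRc⟩ ⟨d, hd, hPd, hQd, hRd⟩
    have hPQ : P ≠ Q := fun h => hP1 (h ▸ Q.2)
    have hcd := uniq hPQ hc hd hPc hQc hPd hQd
    subst hcd
    by_contra hne
    have hne' : (R : X) ≠ R' := fun h => hne (Subtype.ext h)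
    exact hP2 (uniq hne' hc h₂ hRc hRd R.2 R'.2 ▸ hPc)
  choose f hf using hf
  have hinj : Function.Injective f := by
    intro Q Q' h
    obtain ⟨c, hc, hPc, hQc, hRc⟩ := hf Q
    obtain ⟨d, hd, hPd, hQd, hRd⟩ := hf Q'
    rw [← h] at hRd
    have hPR : P ≠ f Q := fun h => hP2 (h ▸ (f Q).2)
    have hcd := uniq hPR hc hd hPc hRc hPd hRd
    subst hcd
    by_contra hne
    have hne' : (Q : X) ≠ Q' := fun h => hne (Subtype.ext h)
    exact hP1 (uniq hne' hc h₁ hQc hQd Q.2 Q'.2 ▸ hPc)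
  have hfin : Finite X := Nat.finite_of_card_ne_zero (by rw [U.card_points]; omega)
  have hcard : Nat.card b₁ = Nat.card b₂ := by
    rw [Nat.card_coe_set_eq, Nat.card_coe_set_eq, U.card_block _ h₁, U.card_block _ h₂]
  have hbij : Function.Bijective f := (Nat.bijective_iff_injective_and_card f).2 ⟨hinj, hcard⟩
  refine ⟨Equiv.ofBijective f hbij, hf, fun π hπ => Equiv.ext fun Q => ?_⟩
  exact key Q _ _ (hπ Q) (hf Q)

end AbstractUnital

/-!
The lines carrying two disjoint blocks `b₁` and `b₂` meet in a point that is not in the unital.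
Choose homogeneous coordinates in which `b₁` consists of points `(α, 1, 0)`, `b₂` of points
`(α, 0, 1)` and the remaining points of the unital are `(α, β, 1)` with `β ≠ 0`
(`AbstractUnital.exists_isAdaptedCoordinates`). The perspectivity with center `P` then becomes the
affine map `t ↦ α P - β P * t`, so that the group of perspectivities consists of affine permutations
of the set of `q + 1` field elements given by `b₁`
(`AbstractUnital.IsAdaptedCoordinates.persp_le_affinePerms`).

Let `t ↦ a * t + b` preserve a set of `q + 1` elements of the field `K` with `q ^ 2` elements.
As `q + 1 = 1` in `K`, the map fixes the sum of these elements; hence it is the identity if `a = 1`,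
and the multiplier `a` embeds the group into the cyclic group `Kˣ` of order `q ^ 2 - 1`. If the map
fixes an element of the set, comparing the products of the differences to this element gives
`a ^ q = 1`, whence `a = 1` (`multiplier_eq_one_of_fixed`). So the group is semi-regular.

In the same way a perspectivity `b₁ → b₂` maps the sum of the `α`-coordinates of `b₁` to that of
`b₂`, which puts all full points on one line. If there are at least two of them, that line carries a
block `c`. Were `c` to meet `b₁` or `b₂`, it would meet `b₁` in a point on which the perspectivities
with two centers on `c` agree, and semi-regularity would make the two centers equal. If there is at
most one full point, a block missing `b₁` and `b₂` is found by counting the blocks through a point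
(`AbstractUnital.isFullPointRegularTriple_of_subsingleton`).
-/

/-! ### Affine permutations of a subset of a finite field -/

section Affine

variable {K : Type*} [Field K] {q : ℕ}

theorem two_le_of_card_eq_sq [Fintype K] (hK : Fintype.card K = q ^ 2) : 2 ≤ q := by
  by_contra! h
  have h1 := Fintype.one_lt_card (α := K)
  interval_cases q <;> simp_all

theorem natCast_eq_zero_of_card_eq_sq [Fintype K] (hK : Fintype.card K = q ^ 2) :
    (q : K) = 0 := by
  have h := Nat.cast_card_eq_zero K
  rw [hK] at h
  push_cast at h
  exact pow_eq_zero_iff two_ne_zero |>.1 h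

theorem eq_one_of_pow_eq_one_of_card_eq_sq [Fintype K] (hK : Fintype.card K = q ^ 2) {a : K}
    (ha : a ^ q = 1) : a = 1 := by
  have h := FiniteField.pow_card a
  rwa [hK, sq, pow_mul, ha, one_pow, eq_comm] at h

/-- An affine bijection between two families of field elements maps the sum of the first to the
sum of the second if the number of elements is `1` in the field. -/
theorem sum_eq_of_affine {S T : Type*} [Fintype S] [Fintype T] (hS : (Fintype.card S : K) = 1)
    {σ : S → K} {τ : T → K} (π : S ≃ T) {a b : K} (h : ∀ x, τ (π x) = a * σ x + b) :
    ∑ y, τ y = a * ∑ x, σ x + b := by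
  rw [← π.sum_comp, Finset.sum_congr rfl fun x _ => h x, Finset.sum_add_distrib, Finset.mul_sum,
    Finset.sum_const, Finset.card_univ, nsmul_eq_mul, hS, one_mul]

/-- The permutations of a family `α` of field elements induced by affine maps `t ↦ a * t + b`. -/
def affinePerms {S : Type*} (α : S → K) : Subgroup (Equiv.Perm S) where
  carrier := {g | ∃ (a : Kˣ) (b : K), ∀ x, α (g x) = a * α x + b}
  one_mem' := ⟨1, 0, by simp⟩
  mul_mem' := by
    rintro g h ⟨a, b, hg⟩ ⟨c, d, hh⟩
    refine ⟨a * c, a * d + b, fun x => ?_⟩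
    rw [Equiv.Perm.mul_apply, hg, hh, Units.val_mul]
    ring
  inv_mem' := by
    rintro g ⟨a, b, hg⟩
    refine ⟨a⁻¹, -(↑a⁻¹ * b), fun x => ?_⟩
    have h := hg (g⁻¹ x)
    rw [← Equiv.Perm.mul_apply, mul_inv_cancel, Equiv.Perm.one_apply] at h
    rw [h, mul_add, Units.inv_mul_cancel_left]
    ring

variable {S : Type*} {α : S → K}

theorem affine_multiplier_eq (hα : Function.Injective α) {x₀ x₁ : S} (hx : x₀ ≠ x₁)
    {g : Equiv.Perm S} {a b : K} (h : ∀ x, α (g x) = a * α x + b) :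
    (α (g x₁) - α (g x₀)) / (α x₁ - α x₀) = a := by
  have hne : α x₁ - α x₀ ≠ 0 := sub_ne_zero.2 fun h => hx (hα h).symm
  rw [div_eq_iff hne, h, h]
  ring

/-- The multiplier `a` of the permutation induced by `t ↦ a * t + b`, read off from the images of
two distinct points. -/
def affineMultiplier (hα : Function.Injective α) {x₀ x₁ : S} (hx : x₀ ≠ x₁) :
    affinePerms α →* K where
  toFun g := (α (g.1 x₁) - α (g.1 x₀)) / (α x₁ - α x₀)
  map_one' := by
    obtain ⟨a, b, h⟩ := (1 : affinePerms α).2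
    exact affine_multiplier_eq hα hx (b := 0) (by simp)
  map_mul' := by
    rintro ⟨g, a, b, hg⟩ ⟨h, c, d, hh⟩
    rw [affine_multiplier_eq hα hx hg, affine_multiplier_eq hα hx hh]
    refine affine_multiplier_eq hα hx (b := a * d + b) fun x => ?_
    change α (g (h x)) = _
    rw [hg, hh]
    ring

/-- A translation preserving a set whose number of elements is `1` in the field fixes the sum of
these elements, hence is trivial. -/
theorem eq_one_of_multiplier_one [Fintype S] (hS : (Fintype.card S : K) = 1)
    (hα : Function.Injective α) {g : Equiv.Perm S} {b : K} (h : ∀ x, α (g x) = α x + b) :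
    g = 1 := by
  have hb : b = 0 := by
    have := sum_eq_of_affine hS g (a := 1) (b := b) (σ := α) (τ := α) (by simpa using h)
    simpa using this
  exact Equiv.ext fun x => hα (by rw [h, hb, add_zero, Equiv.Perm.one_apply])

/-- If an affine map preserves a set of `q + 1` elements of the field of order `q ^ 2` and fixes
one of them, then comparing the products of the differences to the fixed element shows that the
multiplier `a` satisfies `a ^ q = 1`, so that `a = 1`. -/
theorem multiplier_eq_one_of_fixed [Fintype K] (hK : Fintype.card K = q ^ 2) [Fintype S]
    (hS : Fintype.card S = q + 1) (hα : Function.Injective α) {g : Equiv.Perm S} {a b : K}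
    (h : ∀ x, α (g x) = a * α x + b) {x₀ : S} (h₀ : g x₀ = x₀) : a = 1 := by
  classical
  have key : ∏ x ∈ Finset.univ.erase x₀, (α x - α x₀) =
      a ^ q * ∏ x ∈ Finset.univ.erase x₀, (α x - α x₀) := by
    calc ∏ x ∈ Finset.univ.erase x₀, (α x - α x₀)
        = ∏ x ∈ Finset.univ.erase x₀, (α (g x) - α x₀) := by
          refine (Finset.prod_bij (fun x _ => g x) ?_ ?_ ?_ ?_).symm
          · intro x hx
            simp only [Finset.mem_erase, Finset.mem_univ, and_true] at hx ⊢
            exact fun h' => hx (g.injective (h'.trans h₀.symm))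
          · exact fun x _ y _ hxy => g.injective hxy
          · intro y hy
            refine ⟨g.symm y, ?_, by simp⟩
            simp only [Finset.mem_erase, Finset.mem_univ, and_true] at hy ⊢
            intro h'
            rw [g.symm_apply_eq, h₀] at h'
            exact hy h'
          · exact fun _ _ => rfl
      _ = ∏ x ∈ Finset.univ.erase x₀, (a * (α x - α x₀)) := by
          refine Finset.prod_congr rfl fun x _ => ?_
          have := h x₀
          rw [h₀] at this
          rw [h, mul_sub]
          linear_combination -this
      _ = _ := by
          rw [Finset.prod_mul_distrib, Finset.prod_const, Finset.card_erase_of_mem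
            (Finset.mem_univ _), Finset.card_univ, hS, Nat.add_sub_cancel]
  have hne : ∏ x ∈ Finset.univ.erase x₀, (α x - α x₀) ≠ 0 :=
    Finset.prod_ne_zero_iff.2 fun x hx => sub_ne_zero.2 fun h' => (Finset.mem_erase.1 hx).1 (hα h')
  exact eq_one_of_pow_eq_one_of_card_eq_sq hK (mul_right_cancel₀ hne (by rw [← key, one_mul]))

theorem natCast_card_eq_one [Fintype K] (hK : Fintype.card K = q ^ 2) [Fintype S]
    (hS : Fintype.card S = q + 1) : (Fintype.card S : K) = 1 := by
  rw [hS, Nat.cast_add, natCast_eq_zero_of_card_eq_sq hK, Nat.cast_one, zero_add]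

theorem isSemiregularPermGroup_of_le_affinePerms [Fintype K] (hK : Fintype.card K = q ^ 2)
    [Fintype S] (hS : Fintype.card S = q + 1) (hα : Function.Injective α)
    {G : Subgroup (Equiv.Perm S)} (hG : G ≤ affinePerms α) : IsSemiregularPermGroup G := by
  intro g hg x hx
  obtain ⟨a, b, h⟩ := hG hg
  rw [multiplier_eq_one_of_fixed hK hS hα h hx] at h
  exact eq_one_of_multiplier_one (natCast_card_eq_one hK hS) hα (b := b) (by simpa using h)

/-- The multiplier embeds a group of affine permutations of `q + 1` elements of the field of order
`q ^ 2` into the multiplicative group of that field. -/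
theorem exists_injective_to_units [Fintype K] (hK : Fintype.card K = q ^ 2)
    [Fintype S] (hS : Fintype.card S = q + 1) (hα : Function.Injective α)
    {G : Subgroup (Equiv.Perm S)} (hG : G ≤ affinePerms α) :
    ∃ φ : G →* Kˣ, Function.Injective φ := by
  have h2 := two_le_of_card_eq_sq hK
  obtain ⟨x₀, x₁, hx⟩ := Fintype.exists_pair_of_one_lt_card (α := S) (by omega)
  refine ⟨((affineMultiplier hα hx).comp (Subgroup.inclusion hG)).toHomUnits,
    (injective_iff_map_eq_one _).2 ?_⟩
  rintro ⟨g, hg⟩ h1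
  obtain ⟨a, b, h⟩ := hG hg
  have ha : (a : K) = 1 := by
    rw [← affine_multiplier_eq hα hx h]
    exact congrArg Units.val h1
  rw [ha] at h
  exact Subtype.ext
    (eq_one_of_multiplier_one (natCast_card_eq_one hK hS) hα (b := b) (by simpa using h))

end Affine

/-! ### Blocks and full points of a unital -/

namespace AbstractUnital

variable {X : Type*} {n : ℕ}

theorem finite_points (U : AbstractUnital X n) : Finite X :=
  Nat.finite_of_card_ne_zero (by rw [U.card_points]; omega)

theorem block_eq_of_mem (U : AbstractUnital X n) {x y : X} (hxy : x ≠ y) {c d : Set X}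
    (hc : c ∈ U.blocks) (hd : d ∈ U.blocks) (hxc : x ∈ c) (hyc : y ∈ c) (hxd : x ∈ d)
    (hyd : y ∈ d) : c = d :=
  (U.existsUnique_block _ _ hxy).unique ⟨hc, hxc, hyc⟩ ⟨hd, hxd, hyd⟩

/-- There are `n ^ 2` blocks through a point `P`, and any two of them have only `P` in common; so a
set of fewer than `n ^ 2` points other than `P` misses one of them. -/
theorem exists_block_disjoint (U : AbstractUnital X n) {P : X} {D : Set X} (hP : P ∉ D)
    (hD : D.ncard < n ^ 2) : ∃ c ∈ U.blocks, P ∈ c ∧ Disjoint c D := by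
  classical
  have := U.finite_points
  have := Fintype.ofFinite X
  -- otherwise the `n ^ 3` points other than `P` are covered by the blocks joining `P` to `D`
  by_contra! hcon
  have hn : 0 < n := Nat.pos_of_ne_zero (by rintro rfl; simp at hD)
  have hblk : ∀ Q : D, ∃ c ∈ U.blocks, P ∈ c ∧ (Q : X) ∈ c := fun Q => by
    obtain ⟨c, ⟨hc, h1, h2⟩, -⟩ := U.existsUnique_block P Q fun h => hP (h ▸ Q.2)
    exact ⟨c, hc, h1, h2⟩
  choose B hB hPB hQB using hblk
  have hsub : {P}ᶜ ⊆ ⋃ Q : D, B Q \ {P} := by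
    intro y hy
    obtain ⟨c, ⟨hc, h1, h2⟩, -⟩ := U.existsUnique_block P y (Ne.symm hy)
    obtain ⟨Q, hQc, hQD⟩ := Set.not_disjoint_iff.1 (hcon c hc h1)
    refine Set.mem_iUnion.2 ⟨⟨Q, hQD⟩, ?_, hy⟩
    have hPQ : P ≠ Q := fun h => hP (h ▸ hQD)
    rwa [← U.block_eq_of_mem hPQ hc (hB ⟨Q, hQD⟩) h1 hQc (hPB _) (hQB _)]
  have h1 := (Set.ncard_le_ncard hsub).trans (Set.ncard_iUnion_le_of_fintype _)
  have h2 : ∀ Q : D, (B Q \ {P}).ncard = n := fun Q => by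
    rw [Set.ncard_sdiff_singleton_of_mem (hPB Q), U.card_block _ (hB Q), Nat.add_sub_cancel]
  rw [Set.ncard_compl, Set.ncard_singleton, U.card_points, Nat.add_sub_cancel] at h1
  simp only [h2, Finset.sum_const, Finset.card_univ, smul_eq_mul, ← Nat.card_eq_fintype_card,
    Nat.card_coe_set_eq] at h1
  have h3 : D.ncard * n < n ^ 2 * n := Nat.mul_lt_mul_of_pos_right hD hn
  rw [← pow_succ] at h3
  exact absurd h1 (not_le.2 h3)

/-- A block through a full point that meets `b₂` also meets `b₁`, since the perspectivity `b₁ → b₂`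
is surjective. -/
theorem inter_nonempty_of_mem_fullPoints (U : AbstractUnital X n) {b₁ b₂ c : Set X} {P R : X}
    (h₁ : b₁ ∈ U.blocks) (h₂ : b₂ ∈ U.blocks) (hP : P ∈ U.fullPoints b₁ b₂)
    (hc : c ∈ U.blocks) (hPc : P ∈ c) (hR : R ∈ b₂) (hRc : R ∈ c) : (b₁ ∩ c).Nonempty := by
  obtain ⟨π, hπ, -⟩ := U.existsUnique_isPerspectivity h₁ h₂ hP
  obtain ⟨d, hd, hPd, hQd, hRd⟩ := hπ (π.symm ⟨R, hR⟩)
  rw [Equiv.apply_symm_apply] at hRd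
  refine ⟨π.symm ⟨R, hR⟩, (π.symm ⟨R, hR⟩).2, ?_⟩
  have hPR : P ≠ R := fun h => hP.1 (Or.inr (h ▸ hR))
  rwa [U.block_eq_of_mem hPR hc hd hPc hRc hPd hRd]

/-- In a unital of order `2`, each of the nine blocks joining two disjoint blocks has its third
point among the three remaining points, so three of these blocks share that point. -/
theorem fullPoints_nonempty_of_two (U : AbstractUnital X 2) {b₁ b₂ : Set X}
    (h₁ : b₁ ∈ U.blocks) (h₂ : b₂ ∈ U.blocks) (hd : Disjoint b₁ b₂) :
    (U.fullPoints b₁ b₂).Nonempty := by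
  classical
  have := U.finite_points
  have := Fintype.ofFinite X
  have hthird : ∀ z : b₁ × b₂, ∃ P, P ∉ b₁ ∪ b₂ ∧ ∃ c ∈ U.blocks, P ∈ c ∧ (z.1 : X) ∈ c ∧
      (z.2 : X) ∈ c := by
    rintro ⟨⟨Q, hQ⟩, R, hR⟩
    have hQR : Q ≠ R := fun h => Set.disjoint_left.1 hd hQ (h ▸ hR)
    obtain ⟨c, ⟨hc, hQc, hRc⟩, -⟩ := U.existsUnique_block Q R hQR
    have hlt : ({Q, R} : Set X).ncard < c.ncard := by
      rw [U.card_block c hc, Set.ncard_pair hQR]; norm_num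
    obtain ⟨P, hPc, hP⟩ := Set.exists_mem_notMem_of_ncard_lt_ncard hlt
    simp only [Set.mem_insert_iff, Set.mem_singleton_iff, not_or] at hP
    refine ⟨P, ?_, c, hc, hPc, hQc, hRc⟩
    rintro (h | h)
    · exact Set.disjoint_left.1 hd (U.block_eq_of_mem hP.1 hc h₁ hPc hQc h hQ ▸ hRc) hR
    · exact Set.disjoint_left.1 hd hQ (U.block_eq_of_mem hP.2 hc h₂ hPc hRc h hR ▸ hQc)
  choose t ht B hB htB hQB hRB using hthird
  have hb₁ : Fintype.card b₁ = 3 := by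
    rw [← Nat.card_eq_fintype_card, Nat.card_coe_set_eq, U.card_block _ h₁]
  have hb₂ : Fintype.card b₂ = 3 := by
    rw [← Nat.card_eq_fintype_card, Nat.card_coe_set_eq, U.card_block _ h₂]
  have hout : (b₁ ∪ b₂)ᶜ.toFinset.card = 3 := by
    rw [← Set.ncard_eq_toFinset_card', Set.ncard_compl, Set.ncard_union_eq hd, U.card_points,
      U.card_block _ h₁, U.card_block _ h₂]
    norm_num
  obtain ⟨P, hP, hcard⟩ := Finset.exists_lt_card_fiber_of_mul_lt_card_of_maps_to
    (s := Finset.univ) (f := t) (t := (b₁ ∪ b₂)ᶜ.toFinset) (n := 2)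
    (fun z _ => by simpa using ht z)
    (by rw [hout, Finset.card_univ, Fintype.card_prod, hb₁, hb₂]; norm_num)
  have hP' : P ∉ b₁ ∪ b₂ := by simpa using hP
  refine ⟨P, hP', ?_⟩
  set s : Finset (b₁ × b₂) := {z ∈ Finset.univ | t z = P} with hs
  -- the block joining `P` to a point of `b₁` contains at most one point of `b₂`
  have hinj : Set.InjOn Prod.fst (s : Set (b₁ × b₂)) := by
    rintro ⟨Q, R⟩ hz ⟨Q', R'⟩ hz' (rfl : Q = Q')
    have e1 : t (Q, R) = P := by simpa [hs] using hz
    have e2 : t (Q, R') = P := by simpa [hs] using hz'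
    have hPQ : P ≠ Q := fun h => hP' (Or.inl (h ▸ Q.2))
    have hB' := U.block_eq_of_mem hPQ (hB (Q, R)) (hB (Q, R')) (e1 ▸ htB (Q, R)) (hQB (Q, R))
      (e2 ▸ htB (Q, R')) (hQB (Q, R'))
    refine Prod.ext rfl (Subtype.ext ?_)
    by_contra hne
    have hb := U.block_eq_of_mem hne (hB (Q, R)) h₂ (hRB (Q, R)) (hB' ▸ hRB (Q, R')) R.2 R'.2
    exact hP' (Or.inr (hb ▸ e1 ▸ htB (Q, R)))
  have himg : s.image Prod.fst = Finset.univ := by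
    rw [← Finset.card_eq_iff_eq_univ, hb₁]
    refine le_antisymm (hb₁ ▸ Finset.card_le_univ _) ?_
    rw [Finset.card_image_of_injOn hinj]
    exact hcard
  intro Q hQ
  have hmem : (⟨Q, hQ⟩ : b₁) ∈ s.image Prod.fst := himg ▸ Finset.mem_univ _
  obtain ⟨z, hz, hzQ⟩ := Finset.mem_image.1 hmem
  have e : t z = P := by simpa [hs] using hz
  have hQz : (z.1 : X) = Q := by rw [hzQ]
  exact ⟨B z, hB z, e ▸ htB z, hQz ▸ hQB z, z.2, hRB z, z.2.2⟩

/-- A block missing both `b₁` and `b₂` exists as soon as there is at most one full point; it can be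
chosen through that point. -/
theorem isFullPointRegularTriple_of_subsingleton (U : AbstractUnital X n) (hn : 2 ≤ n)
    {b₁ b₂ : Set X} (h₁ : b₁ ∈ U.blocks) (h₂ : b₂ ∈ U.blocks) (hd : Disjoint b₁ b₂)
    (hF : (U.fullPoints b₁ b₂).Subsingleton) : U.IsFullPointRegularTriple b₁ b₂ := by
  have := U.finite_points
  rcases (U.fullPoints b₁ b₂).eq_empty_or_nonempty with hF0 | ⟨P, hP⟩
  · have hn3 : 3 ≤ n := by
      by_contra! h
      obtain rfl : n = 2 := by omega
      exact (U.fullPoints_nonempty_of_two h₁ h₂ hd).ne_empty hF0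
    have hcard : (b₁ ∪ b₂).ncard = 2 * (n + 1) := by
      rw [Set.ncard_union_eq hd, U.card_block _ h₁, U.card_block _ h₂]; ring
    obtain ⟨P, hP⟩ : ∃ P, P ∉ b₁ ∪ b₂ := by
      by_contra! h
      rw [Set.eq_univ_of_forall h, Set.ncard_univ, U.card_points] at hcard
      nlinarith [Nat.mul_le_mul hn3 hn3, Nat.mul_le_mul (Nat.mul_le_mul hn3 hn3) (le_refl n)]
    obtain ⟨c, hc, -, hcd⟩ := U.exists_block_disjoint hP (by rw [hcard]; nlinarith)
    rw [Set.disjoint_union_right] at hcd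
    exact ⟨c, hc, hcd.1.symm.inter_eq, hcd.2.symm.inter_eq, by simp [hF0]⟩
  · obtain ⟨c, hc, hPc, hcd⟩ := U.exists_block_disjoint (P := P) (D := b₁)
      (fun h => hP.1 (Or.inl h)) (by rw [U.card_block _ h₁]; nlinarith)
    refine ⟨c, hc, hcd.symm.inter_eq, ?_, fun R hR => hF hR hP ▸ hPc⟩
    rw [Set.eq_empty_iff_forall_notMem]
    rintro R ⟨hR, hRc⟩
    obtain ⟨Q, hQ, hQc⟩ := U.inter_nonempty_of_mem_fullPoints h₁ h₂ hP hc hPc hR hRc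
    exact Set.disjoint_left.1 hcd hQc hQ

end AbstractUnital

/-! ### Coordinates adapted to two disjoint blocks -/

namespace AbstractUnital

open Matrix

variable {X K : Type*} [Field K] {n : ℕ}

/-- Normalized homogeneous coordinates `(α, β, γ)` of the points of a unital embedded in a
projective plane, in which the blocks `b₁` and `b₂` lie on the lines `γ = 0` and `β = 0`. The points
of `b₁` are `(α, 1, 0)`, those of `b₂` are `(α, 0, 1)` and all others are `(α, β, 1)` with
`β ≠ 0`. -/
structure IsAdaptedCoordinates (U : AbstractUnital X n) (b₁ b₂ : Set X) (α β γ : X → K) :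
    Prop where
  beta_left : ∀ x ∈ b₁, β x = 1
  gamma_left : ∀ x ∈ b₁, γ x = 0
  gamma_of_notMem : ∀ x ∉ b₁, γ x = 1
  beta_right : ∀ x ∈ b₂, β x = 0
  beta_ne_zero : ∀ x ∉ b₂, β x ≠ 0
  ext : ∀ x y, α x = α y → β x = β y → γ x = γ y → x = y
  block_eq : ∀ c ∈ U.blocks, ∃ r s t : K, ¬(r = 0 ∧ s = 0 ∧ t = 0) ∧
    ∀ x, x ∈ c ↔ r * α x + s * β x + t * γ x = 0

/-- Two independent linear forms on `K ^ 3` are completed to a basis of the dual space by one of the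
coordinate forms, because their cross product has a nonzero entry. -/
theorem exists_det_ne_zero {φ ψ : Fin 3 → K} (h : LinearIndependent K ![ψ, φ]) :
    ∃ i : Fin 3, det (of ![Pi.single i 1, ψ, φ]) ≠ 0 := by
  rw [← crossProduct_ne_zero_iff_linearIndependent] at h
  obtain ⟨i, hi⟩ := Function.ne_iff.1 h
  refine ⟨i, ?_⟩
  have := triple_product_eq_det (Pi.single i 1) ψ φ
  rw [single_one_dotProduct] at this
  change det ![Pi.single i 1, ψ, φ] ≠ 0
  rw [← this]
  exact hi

theorem mem_iff_dotProduct_rep {v w : ℙ K (Fin 3 → K)} : v ∈ w ↔ w.rep ⬝ᵥ v.rep = 0 := by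
  rw [Configuration.ofField.mem_iff, dotProduct_comm,
    ← Projectivization.orthogonal_mk v.rep_nonzero w.rep_nonzero, v.mk_rep, w.mk_rep]

theorem exists_isAdaptedCoordinates (U : AbstractUnital X n) {f : X → ℙ K (Fin 3 → K)}
    (hf : U.IsEmbedding (ℙ K (Fin 3 → K)) f) {b₁ b₂ : Set X} (h₁ : b₁ ∈ U.blocks)
    (h₂ : b₂ ∈ U.blocks) (hd : Disjoint b₁ b₂) :
    ∃ α β γ : X → K, U.IsAdaptedCoordinates b₁ b₂ α β γ := by
  classical
  have hline : ∀ c ∈ U.blocks, ∃ l : ℙ K (Fin 3 → K), ∀ x, x ∈ c ↔ l.rep ⬝ᵥ (f x).rep = 0 := by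
    intro c hc
    obtain ⟨l, hl⟩ := hf.block_eq c hc
    refine ⟨l, fun x => ?_⟩
    rw [← hf.injective.mem_set_image, hl, ← mem_iff_dotProduct_rep]
    simp
  obtain ⟨l₁, hl₁⟩ := hline b₁ h₁
  obtain ⟨l₂, hl₂⟩ := hline b₂ h₂
  have hne : l₂ ≠ l₁ := by
    rintro rfl
    have hb : b₁ = b₂ := Set.ext fun x => (hl₁ x).trans (hl₂ x).symm
    subst hb
    have h := U.card_block _ h₁
    rw [disjoint_self.1 hd] at h
    simp at h
  have hind : LinearIndependent K ![l₂.rep, l₁.rep] := by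
    rw [← Projectivization.independent_mk_iff_LinearIndependent l₂.rep_nonzero l₁.rep_nonzero,
      l₂.mk_rep, l₁.mk_rep, Projectivization.independent_pair_iff_ne]
    exact hne
  obtain ⟨i, hi⟩ := exists_det_ne_zero hind
  set M : Matrix (Fin 3) (Fin 3) K := of ![Pi.single i 1, l₂.rep, l₁.rep] with hM
  have hu : IsUnit M.det := isUnit_iff_ne_zero.2 hi
  have hMu : ∀ w, M *ᵥ w = ![w i, l₂.rep ⬝ᵥ w, l₁.rep ⬝ᵥ w] := by
    intro w
    ext j
    fin_cases j <;> simp [hM, mulVec]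
  -- the scaling factor that normalizes the coordinates
  set k : X → K := fun x => if x ∈ b₁ then l₂.rep ⬝ᵥ (f x).rep else l₁.rep ⬝ᵥ (f x).rep with hk
  have hk1 : ∀ x ∈ b₁, k x = l₂.rep ⬝ᵥ (f x).rep := fun x hx => if_pos hx
  have hk2 : ∀ x ∉ b₁, k x = l₁.rep ⬝ᵥ (f x).rep := fun x hx => if_neg hx
  have hk0 : ∀ x, k x ≠ 0 := by
    intro x
    by_cases hx : x ∈ b₁
    · rw [hk1 x hx]
      exact fun h => Set.disjoint_left.1 hd hx ((hl₂ x).2 h)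
    · rw [hk2 x hx]
      exact fun h => hx ((hl₁ x).2 h)
  refine ⟨fun x => (f x).rep i / k x, fun x => l₂.rep ⬝ᵥ (f x).rep / k x,
    fun x => l₁.rep ⬝ᵥ (f x).rep / k x, ?_⟩
  constructor
  · intro x hx
    rw [← hk1 x hx, div_self (hk0 x)]
  · intro x hx
    rw [(hl₁ x).1 hx, zero_div]
  · intro x hx
    rw [← hk2 x hx, div_self (hk0 x)]
  · intro x hx
    rw [(hl₂ x).1 hx, zero_div]
  · intro x hx
    exact div_ne_zero (fun h => hx ((hl₂ x).2 h)) (hk0 x)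
  · intro x y e1 e2 e3
    have hv : (f x).rep = (k x / k y) • (f y).rep := by
      apply Matrix.mulVec_injective_of_isUnit ((Matrix.isUnit_iff_isUnit_det M).2 hu)
      rw [mulVec_smul, hMu, hMu]
      have hx := hk0 x
      have hy := hk0 y
      rw [div_eq_div_iff hx hy] at e1 e2 e3
      ext j
      fin_cases j
      · simp only [Fin.zero_eta, cons_val_zero, Pi.smul_apply, smul_eq_mul]
        field_simp
        linear_combination e1
      · simp only [Fin.mk_one, cons_val_one, cons_val_zero, Pi.smul_apply, smul_eq_mul]
        field_simp
        linear_combination e2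
      · simp only [Fin.reduceFinMk, cons_val, Pi.smul_apply, smul_eq_mul]
        field_simp
        linear_combination e3
    apply hf.injective
    rw [← (f x).mk_rep, ← (f y).mk_rep,
      Projectivization.mk_eq_mk_iff' K _ _ (f x).rep_nonzero (f y).rep_nonzero]
    exact ⟨_, hv.symm⟩
  · intro c hc
    obtain ⟨l, hl⟩ := hline c hc
    set v := l.rep ᵥ* M⁻¹ with hv
    have hvM : v ᵥ* M = l.rep := by
      rw [hv, vecMul_vecMul, nonsing_inv_mul M hu, vecMul_one]
    refine ⟨v 0, v 1, v 2, ?_, fun x => ?_⟩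
    · rintro ⟨e0, e1, e2⟩
      apply l.rep_nonzero
      have hv0 : v = 0 := by
        ext j
        fin_cases j
        exacts [e0, e1, e2]
      rw [← hvM, hv0, zero_vecMul]
    · have hdot : l.rep ⬝ᵥ (f x).rep =
          v 0 * (f x).rep i + v 1 * (l₂.rep ⬝ᵥ (f x).rep) + v 2 * (l₁.rep ⬝ᵥ (f x).rep) := by
        rw [← hvM, ← dotProduct_mulVec, hMu, vec3_dotProduct]
        simp
      have hx := hk0 x
      rw [hl x, hdot]
      simp only [mul_div_assoc', ← add_div, div_eq_zero_iff, hx, or_false]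

/-! ### Perspectivities in adapted coordinates -/

namespace IsAdaptedCoordinates

variable {U : AbstractUnital X n} {b₁ b₂ : Set X} {α β γ : X → K}

theorem injective_left (h : U.IsAdaptedCoordinates b₁ b₂ α β γ) :
    Function.Injective fun x : b₁ => α x := fun x y hxy =>
  Subtype.ext (h.ext x y hxy (by rw [h.beta_left x x.2, h.beta_left y y.2])
    (by rw [h.gamma_left x x.2, h.gamma_left y y.2]))

/-- In adapted coordinates the perspectivity with center `P` is the affine map
`t ↦ -β P * t + α P`. -/
theorem perspectivity_apply (h : U.IsAdaptedCoordinates b₁ b₂ α β γ) (hd : Disjoint b₁ b₂) {P : X}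
    (hP : P ∉ b₁ ∪ b₂) {π : b₁ ≃ b₂} (hπ : U.IsPerspectivity P π) (Q : b₁) :
    α (π Q) = -β P * α Q + α P := by
  obtain ⟨c, hc, hPc, hQc, hRc⟩ := hπ Q
  obtain ⟨r, s, t, hne, hmem⟩ := h.block_eq c hc
  have e1 := (hmem _).1 hPc
  have e2 := (hmem _).1 hQc
  have e3 := (hmem _).1 hRc
  rw [h.gamma_of_notMem P fun h' => hP (Or.inl h')] at e1
  rw [h.beta_left _ Q.2, h.gamma_left _ Q.2] at e2
  rw [h.beta_right _ (π Q).2, h.gamma_of_notMem _ (Set.disjoint_right.1 hd (π Q).2)] at e3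
  have hr : r ≠ 0 := by
    rintro rfl
    exact hne ⟨rfl, by simpa using e2, by simpa using e3⟩
  apply mul_left_cancel₀ hr
  linear_combination e3 - e1 + β P * e2

theorem perspectivity_symm_apply (h : U.IsAdaptedCoordinates b₁ b₂ α β γ) (hd : Disjoint b₁ b₂)
    {P : X} (hP : P ∉ b₁ ∪ b₂) {σ : b₂ ≃ b₁} (hσ : U.IsPerspectivity P σ) (R : b₂) :
    α (σ R) = -(β P)⁻¹ * α R + (β P)⁻¹ * α P := by
  have hβ := h.beta_ne_zero P fun h' => hP (Or.inr h')
  have hπ : U.IsPerspectivity P σ.symm := fun Q => by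
    obtain ⟨c, hc, h1, h2, h3⟩ := hσ (σ.symm Q)
    exact ⟨c, hc, h1, by simpa using h3, h2⟩
  have e := h.perspectivity_apply hd hP hπ (σ R)
  rw [Equiv.symm_apply_apply] at e
  rw [e]
  field_simp
  ring

theorem exists_perspectivity_trans_apply (h : U.IsAdaptedCoordinates b₁ b₂ α β γ)
    (hd : Disjoint b₁ b₂) {P Q : X} (hP : P ∉ b₁ ∪ b₂) (hQ : Q ∉ b₁ ∪ b₂) {π : b₁ ≃ b₂}
    {σ : b₂ ≃ b₁} (hπ : U.IsPerspectivity P π) (hσ : U.IsPerspectivity Q σ) :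
    ∃ b : K, ∀ x : b₁, α ((π.trans σ) x) = (β Q)⁻¹ * β P * α x + b := by
  refine ⟨-(β Q)⁻¹ * α P + (β Q)⁻¹ * α Q, fun x => ?_⟩
  rw [Equiv.trans_apply, h.perspectivity_symm_apply hd hQ hσ, h.perspectivity_apply hd hP hπ]
  ring

theorem persp_le_affinePerms (h : U.IsAdaptedCoordinates b₁ b₂ α β γ) (hd : Disjoint b₁ b₂) :
    U.persp b₂ b₁ ≤ affinePerms fun x : b₁ => α x := by
  refine (Subgroup.closure_le _).2 ?_
  rintro g ⟨P, hP, Q, hQ, π, σ, hπ, hσ, rfl⟩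
  obtain ⟨b, hb⟩ := h.exists_perspectivity_trans_apply hd hP.1 hQ.1 hπ hσ
  refine ⟨(Units.mk0 _ (h.beta_ne_zero Q fun h' => hQ.1 (Or.inr h')))⁻¹ *
    Units.mk0 _ (h.beta_ne_zero P fun h' => hP.1 (Or.inr h')), b, fun x => ?_⟩
  simpa using hb x

end IsAdaptedCoordinates

/-! ### The line of the full points -/

variable {q : ℕ} [Fintype K]

/-- Summing the equation of a perspectivity over the `q + 1` points of `b₁`, where `q + 1 = 1` in
`K`, shows that all full points lie on the line
`α = β * ∑ x ∈ b₁, α x + γ * ∑ y ∈ b₂, α y`. -/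
theorem IsAdaptedCoordinates.exists_fullPoints_line (hK : Fintype.card K = q ^ 2)
    {U : AbstractUnital X q} {b₁ b₂ : Set X} {α β γ : X → K} (h₁ : b₁ ∈ U.blocks)
    (h₂ : b₂ ∈ U.blocks) (hd : Disjoint b₁ b₂) (h : U.IsAdaptedCoordinates b₁ b₂ α β γ) :
    ∃ s t : K, ∀ P ∈ U.fullPoints b₁ b₂, α P = β P * s + t := by
  classical
  have := U.finite_points
  have := Fintype.ofFinite X
  refine ⟨∑ x : b₁, α x, ∑ y : b₂, α y, fun P hP => ?_⟩
  obtain ⟨π, hπ, -⟩ := U.existsUnique_isPerspectivity h₁ h₂ hP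
  have hcard : Fintype.card b₁ = q + 1 := by
    rw [← Nat.card_eq_fintype_card, Nat.card_coe_set_eq, U.card_block _ h₁]
  have := sum_eq_of_affine (natCast_card_eq_one hK hcard) (σ := fun x : b₁ => α x)
    (τ := fun y : b₂ => α y) π (h.perspectivity_apply hd hP.1 hπ)
  rw [this]
  ring

/-- If there are two full points `P` and `Q`, the block `c` joining them contains all full points.
A point of `b₁` on `c` would be fixed by the projection from `P` followed by the one back from `Q`,
whose multiplier `β P / β Q` is not `1`. -/
theorem IsAdaptedCoordinates.isFullPointRegularTriple (hK : Fintype.card K = q ^ 2)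
    {U : AbstractUnital X q} {b₁ b₂ : Set X} {α β γ : X → K} (h₁ : b₁ ∈ U.blocks)
    (h₂ : b₂ ∈ U.blocks) (hd : Disjoint b₁ b₂) (h : U.IsAdaptedCoordinates b₁ b₂ α β γ) :
    U.IsFullPointRegularTriple b₁ b₂ := by
  classical
  have := U.finite_points
  have := Fintype.ofFinite X
  by_cases hF : (U.fullPoints b₁ b₂).Subsingleton
  · exact U.isFullPointRegularTriple_of_subsingleton (two_le_of_card_eq_sq hK) h₁ h₂ hd hF
  obtain ⟨P, hP, Q, hQ, hPQ⟩ := Set.not_subsingleton_iff.1 hF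
  obtain ⟨s, t, hline⟩ := h.exists_fullPoints_line hK h₁ h₂ hd
  have hγ : ∀ R ∈ U.fullPoints b₁ b₂, γ R = 1 := fun R hR =>
    h.gamma_of_notMem R fun h' => hR.1 (Or.inl h')
  have hβPQ : β P ≠ β Q := fun e =>
    hPQ (h.ext P Q (by rw [hline P hP, hline Q hQ, e]) e (by rw [hγ P hP, hγ Q hQ]))
  obtain ⟨c, ⟨hc, hPc, hQc⟩, -⟩ := U.existsUnique_block P Q hPQ
  have hb₁ : b₁ ∩ c = ∅ := by
    rw [Set.eq_empty_iff_forall_notMem]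
    rintro x ⟨hx, hxc⟩
    obtain ⟨π, hπ, -⟩ := U.existsUnique_isPerspectivity h₁ h₂ hP
    obtain ⟨σ, hσ, -⟩ := U.existsUnique_isPerspectivity h₁ h₂ hQ
    have hσ' : U.IsPerspectivity Q σ.symm := fun R => by
      obtain ⟨d, hd, e1, e2, e3⟩ := hσ (σ.symm R)
      exact ⟨d, hd, e1, by simpa using e3, e2⟩
    -- both perspectivities send `x` to the intersection of `c` with `b₂`
    have himage : ∀ (R : X) (ρ : b₁ ≃ b₂), R ∈ U.fullPoints b₁ b₂ → R ∈ c →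
        U.IsPerspectivity R ρ → (ρ ⟨x, hx⟩ : X) ∈ c := by
      intro R ρ hR hRc hρ
      obtain ⟨d, hd, e1, e2, e3⟩ := hρ ⟨x, hx⟩
      have hRx : R ≠ x := fun e => hR.1 (Or.inl (e ▸ hx))
      rwa [U.block_eq_of_mem hRx hc hd hRc hxc e1 e2]
    have hfix : (π.trans σ.symm) ⟨x, hx⟩ = ⟨x, hx⟩ := by
      rw [Equiv.trans_apply, Equiv.symm_apply_eq]
      refine Subtype.ext (by_contra fun hne => ?_)
      have := U.block_eq_of_mem hne hc h₂ (himage P π hP hPc hπ) (himage Q σ hQ hQc hσ)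
        (π _).2 (σ _).2
      exact hP.1 (Or.inr (this ▸ hPc))
    obtain ⟨b, hb⟩ := h.exists_perspectivity_trans_apply hd hP.1 hQ.1 hπ hσ'
    have hcard : Fintype.card b₁ = q + 1 := by
      rw [← Nat.card_eq_fintype_card, Nat.card_coe_set_eq, U.card_block _ h₁]
    have hone := multiplier_eq_one_of_fixed hK hcard h.injective_left hb hfix
    have hβQ := h.beta_ne_zero Q fun h' => hQ.1 (Or.inr h')
    rw [inv_mul_eq_iff_eq_mul₀ hβQ, mul_one] at hone
    exact hβPQ hone
  refine ⟨c, hc, hb₁, ?_, ?_⟩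
  · rw [Set.eq_empty_iff_forall_notMem]
    rintro R ⟨hR, hRc⟩
    exact (U.inter_nonempty_of_mem_fullPoints h₁ h₂ hP hc hPc hR hRc).ne_empty hb₁
  · intro R hR
    obtain ⟨k, l, m, -, hmem⟩ := h.block_eq c hc
    have eP := (hmem P).1 hPc
    have eQ := (hmem Q).1 hQc
    rw [hmem R]
    rw [hγ P hP, hline P hP] at eP
    rw [hγ Q hQ, hline Q hQ] at eQ
    rw [hγ R hR, hline R hR]
    -- the equation of `c` is linear in `β` on the line of full points, with two zeros
    have e0 : k * s + l = 0 := by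
      refine (mul_eq_zero.1 ?_).resolve_left (sub_ne_zero.2 hβPQ)
      linear_combination eP - eQ
    linear_combination eP + (β R - β P) * e0

end AbstractUnital

theorem theorem3 {X : Type*} {q : ℕ} {K : Type*} [Field K] [Fintype K]
    (hK : Fintype.card K = q ^ 2) (U : AbstractUnital X q)
    (f : X → ℙ K (Fin 3 → K)) (hf : U.IsEmbedding (ℙ K (Fin 3 → K)) f) :
    U.IsStronglyFullPointRegular ∧
      ∀ b₁ ∈ U.blocks, ∀ b₂ ∈ U.blocks, Disjoint b₁ b₂ →
        Nat.card (U.persp b₂ b₁) ∣ q ^ 2 - 1 := by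
  classical
  have := U.finite_points
  have := Fintype.ofFinite X
  have hcard : ∀ b ∈ U.blocks, Fintype.card b = q + 1 := fun b hb => by
    rw [← Nat.card_eq_fintype_card, Nat.card_coe_set_eq, U.card_block _ hb]
  refine ⟨fun b₁ h₁ b₂ h₂ hd => ?_, fun b₁ h₁ b₂ h₂ hd => ?_⟩ <;>
    obtain ⟨α, β, γ, h⟩ := U.exists_isAdaptedCoordinates hf h₁ h₂ hd <;>
    obtain ⟨φ, hφ⟩ := exists_injective_to_units hK (hcard b₁ h₁) h.injective_left
      (h.persp_le_affinePerms hd)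
  · exact ⟨h.isFullPointRegularTriple hK h₁ h₂ hd, isCyclic_of_injective φ hφ,
      isSemiregularPermGroup_of_le_affinePerms hK (hcard b₁ h₁) h.injective_left
        (h.persp_le_affinePerms hd)⟩
  · have hdvd := Subgroup.card_dvd_of_injective φ hφ
    rwa [Nat.card_units, Nat.card_eq_fintype_card (α := K), hK] at hdvd
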